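/- **Theorem 1.** Let $\mathcal H=\bigotimes_{i=1}^m\mathbb C^{d_i}$ be the Hilbert space of $m$ parties, of total dimension $D=\prod_i d_i$. Let $\{\psi_1,\dots,\psi_n\}\subset\mathcal H$ be an unextendible product basis (UPB): an orthonormal set of product vectors $\psi_j=\bigotimes_i\varphi_{i,j}$ that spans a proper subspace $\mathcal H_S$ of $\mathcal H$ and such that $\mathcal H_S^\perp$ contains no nonzero product vector. Then $$\bar\rho=\frac{1}{D-n}\Bigl(\mathbf 1-\sum_{j=1}^n|\psi_j\rangle\langle\psi_j|\Bigr)$$ is a bound entangled state, and it has positive partial transpose across every bipartite cut. That is: 1. $\bar\rho$ is a density operator (positive semidefinite, of trace one). 2. $\bar\rho$ is entangled: it is not a finite convex combination of projectors $|\varphi\rangle\langle\varphi|$ onto unit product vectors $\varphi=\bigotimes_i\varphi_i$. 3. No pure entanglement can be distilled from $\bar\rho$: for all local dimensions $\tau_1,\dots,\tau_m$ and every unit vector $\phi\in\bigotimes_i\mathbb C^{\tau_i}$ that is not a product vector there is $\varepsilon>0$ such that $\langle\phi|\Lambda(\bar\rho^{\otimes N})|\phi\rangle\le1-\varepsilon$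 for every $N$ and every channel $\Lambda$ that the $m$ parties can implement by finitely many rounds of local operations and classical communication (LOCC), party $i$ holding the $i$-th tensor factors of all $N$ copies. 4. For every set $S$ of parties, the partial transpose of $\bar\rho$ with respect to the parties in $S$ (in the standard basis) is positive semidefinite. -/

import Mathlib

open scoped Matrix ComplexOrder

noncomputable section

namespace UPB

/-- Labels of the computational product basis of `⨂ i, ℂ^(d i)`. -/
abbrev Idx {m : ℕ} (d : Fin m → ℕ) : Type := ∀ i, Fin (d i)

/-- The Hilbert space `⨂ i, ℂ^(d i)` of `m` parties with local dimensions `d i`, in coordinates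
with respect to the computational product basis. -/
abbrev Space {m : ℕ} (d : Fin m → ℕ) : Type := EuclideanSpace ℂ (Idx d)

/-- Operators on `⨂ i, ℂ^(d i)`. -/
abbrev Op {m : ℕ} (d : Fin m → ℕ) : Type := Matrix (Idx d) (Idx d) ℂ

/-- The product vector `⨂ i, v i`. -/
def tensorVec {m : ℕ} {d : Fin m → ℕ} (v : ∀ i, EuclideanSpace ℂ (Fin (d i))) : Space d :=
  WithLp.toLp 2 fun x => ∏ i, v i (x i)

/-- `ψ` is a product vector. -/
def IsProduct {m : ℕ} {d : Fin m → ℕ} (ψ : Space d) : Prop :=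
  ∃ v : ∀ i, EuclideanSpace ℂ (Fin (d i)), ψ = tensorVec v

/-- The operator `|ψ⟩⟨ψ|`. -/
def proj {m : ℕ} {d : Fin m → ℕ} (ψ : Space d) : Op d :=
  Matrix.of fun x y => ψ x * star (ψ y)

/-- An (incomplete orthogonal) product basis: orthonormal product vectors that span a proper
subspace. -/
structure IsPB {m : ℕ} {d : Fin m → ℕ} {n : ℕ} (ψ : Fin n → Space d) : Prop where
  orthonormal : Orthonormal ℂ ψ
  product : ∀ j, IsProduct (ψ j)
  incomplete : Submodule.span ℂ (Set.range ψ) ≠ ⊤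

/-- An unextendible product basis: a product basis such that the orthogonal complement of its span
contains no product state (product states are nonzero product vectors, up to normalization). -/
structure IsUPB {m : ℕ} {d : Fin m → ℕ} {n : ℕ} (ψ : Fin n → Space d) : Prop
    extends IsPB ψ where
  unextendible : ∀ φ ∈ (Submodule.span ℂ (Set.range ψ))ᗮ, IsProduct φ → φ = 0

/-- The uniform mixture `(1 - ∑ j, |ψ j⟩⟨ψ j|) / (D - n)`, where `D = ∏ i, d i`. -/
def complementaryState {m : ℕ} {d : Fin m → ℕ} {n : ℕ} (ψ : Fin n → Space d) : Op d :=
  (1 / (((∏ i, d i : ℕ) : ℂ) - (n : ℂ))) • (1 - ∑ j, proj (ψ j))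

/-- Density operators. -/
def IsDensity {m : ℕ} {d : Fin m → ℕ} (ρ : Op d) : Prop :=
  ρ.PosSemidef ∧ ρ.trace = 1

/-- (Full) separability: `ρ` is a finite mixture of pure product states. -/
def IsSeparable {m : ℕ} {d : Fin m → ℕ} (ρ : Op d) : Prop :=
  ∃ (k : ℕ) (p : Fin k → ℝ) (φ : Fin k → Space d),
    (∀ a, 0 ≤ p a) ∧ ∑ a, p a = 1 ∧ (∀ a, ‖φ a‖ = 1 ∧ IsProduct (φ a)) ∧
      ρ = ∑ a, (p a : ℂ) • proj (φ a)

/-- Partial transposition, in the computational basis, of the parties in `S`. -/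
def partialTranspose {m : ℕ} {d : Fin m → ℕ} (S : Finset (Fin m)) (ρ : Op d) : Op d :=
  Matrix.of fun x y =>
    ρ (fun i => if i ∈ S then y i else x i) (fun i => if i ∈ S then x i else y i)

/-- The product operator `⨂ i, A i`. -/
def tensorOp {m : ℕ} {d e : Fin m → ℕ} (A : ∀ i, Matrix (Fin (e i)) (Fin (d i)) ℂ) :
    Matrix (Idx e) (Idx d) ℂ :=
  Matrix.of fun x y => ∏ i, A i (x i) (y i)

/-- Finite protocols of local operations and classical communication that turn a system with local
dimensions `d` into one with local dimensions `τ`.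

In one round, some party `i` performs a local measurement with Kraus operators `A o i` (one for each
outcome `o`) and announces the outcome to all the parties; every other party `j` applies a local
isometry `A o j`, which may depend on the announced outcome; the rest of the protocol, including
the choice of the next party and its measurement, may depend on the outcome as well.
The local dimensions may change in every round. Thus local ancillas may be added (isometries), and
local subsystems may be discarded, or local channels applied, by measuring and ignoring the outcome;
a party that does nothing applies the isometry `1`. -/
inductive LOCC {m : ℕ} (τ : Fin m → ℕ) : (Fin m → ℕ) → Type
  | done : LOCC τ τ
  | round {d : Fin m → ℕ} (i : Fin m) (r : ℕ) (e : Fin r → Fin m → ℕ)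
      (A : ∀ (o : Fin r) (j : Fin m), Matrix (Fin (e o j)) (Fin (d j)) ℂ)
      (measurement : ∑ o, (A o i)ᴴ * A o i = 1)
      (isometry : ∀ o, ∀ j, j ≠ i → (A o j)ᴴ * A o j = 1)
      (next : ∀ o, LOCC τ (e o)) : LOCC τ d

/-- The quantum channel implemented by a protocol (the sum over all measurement outcomes). -/
def LOCC.apply {m : ℕ} {τ : Fin m → ℕ} : ∀ {d : Fin m → ℕ}, LOCC τ d → Op d → Op τ
  | _, .done, ρ => ρ
  | _, .round _ _ _ A _ _ next, ρ =>
      ∑ o, (next o).apply (tensorOp (A o) * ρ * (tensorOp (A o))ᴴ)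

/-- `N` copies `ρ^{⊗ N}`, as an operator on a system in which party `i` holds its `N` local systems
of dimension `d i`, i.e. the space `(ℂ^(d i))^{⊗ N} = ℂ^(d i ^ N)`. -/
def copies {m : ℕ} {d : Fin m → ℕ} (ρ : Op d) (N : ℕ) : Op (fun i => d i ^ N) :=
  Matrix.of fun x y => ∏ k : Fin N,
    ρ (fun i => finFunctionFinEquiv.symm (x i) k) (fun i => finFunctionFinEquiv.symm (y i) k)

/-- The fidelity `⟨φ|σ|φ⟩` of `σ` with the pure state `φ`. -/
def fidelity {m : ℕ} {d : Fin m → ℕ} (φ : Space d) (σ : Op d) : ℝ :=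
  (∑ x, ∑ y, star (φ x) * σ x y * φ y).re

/-- Pure entanglement can be distilled from `ρ`: for some entangled pure state `φ` of the `m`
parties (of any local dimensions), the parties can obtain `φ` with fidelity arbitrarily close to `1`
by local operations and classical communication from sufficiently many copies of `ρ`. -/
def IsDistillable {m : ℕ} {d : Fin m → ℕ} (ρ : Op d) : Prop :=
  ∃ (τ : Fin m → ℕ) (φ : Space τ), ‖φ‖ = 1 ∧ ¬ IsProduct φ ∧
    ∀ ε : ℝ, 0 < ε → ∃ (N : ℕ) (P : LOCC τ (fun i => d i ^ N)),
      1 - ε < fidelity φ (P.apply (copies ρ N))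

/-- Bound entangled states: entangled (i.e. not separable) states from which no pure entanglement
can be distilled. -/
def IsBoundEntangled {m : ℕ} {d : Fin m → ℕ} (ρ : Op d) : Prop :=
  IsDensity ρ ∧ ¬ IsSeparable ρ ∧ ¬ IsDistillable ρ

end UPB

end

/-!
Everything is expressed through the quantities `tr (|φ⟩⟨φ| A) = ⟨φ|A|φ⟩`.

The state `ρ̄` has no overlap with any `ψ j`, so neither has any component of a decomposition of
`ρ̄` into product states; such a component would be a product vector orthogonal to the UPB.

Partial transposition maps `|ψ j⟩⟨ψ j|` to the projector onto the product vector whose factors in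
`S` are complex conjugated. It preserves the Hilbert–Schmidt pairing, hence orthonormality, and
Bessel's inequality makes the partial transposes of `ρ̄` positive. Their positivity survives taking
copies and LOCC protocols.

An entangled pure state `φ` has a partial transpose `X` (of a single party) with a negative
eigenvalue. As `tr X² = tr |φ⟩⟨φ|² = 1`, all other eigenvalues of `X` are at most some `c < 1`.
If `σ` has trace one and a positive partial transpose `Y`, then `⟨φ|σ|φ⟩ = tr (X Y) ≤ c`.
-/

namespace UPB

open Finset Function

section Matrix

variable {𝕜 ι : Type*} [RCLike 𝕜]

lemma posSemidef_prod_submatrix {κ X : Type*} [Finite X] {A : Matrix ι ι 𝕜} (hA : A.PosSemidef)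
    (f : κ → X → ι) (s : Finset κ) :
    (Matrix.of fun x y => ∏ k ∈ s, A (f k x) (f k y)).PosSemidef := by
  classical
  induction s using Finset.induction_on with
  | empty =>
    convert! Matrix.posSemidef_vecMulVec_self_star (1 : X → 𝕜) using 1
    ext x y
    simp [Matrix.vecMulVec_apply]
  | insert k s hk ih =>
    convert! (hA.submatrix (f k)).hadamard ih using 1
    ext x y
    simp [hk]

variable [Fintype ι]

lemma trace_mul_nonneg {A B : Matrix ι ι 𝕜} (hA : A.PosSemidef) (hB : B.PosSemidef) :
    0 ≤ (A * B).trace := by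
  obtain ⟨C, rfl⟩ : ∃ C : Matrix ι ι 𝕜, B = Cᴴ * C := by
    classical
    open scoped MatrixOrder in
    exact CStarAlgebra.nonneg_iff_eq_star_mul_self.1 hB.nonneg
  rw [← Matrix.mul_assoc, Matrix.trace_mul_comm, ← Matrix.mul_assoc]
  exact (hA.mul_mul_conjTranspose_same C).trace_nonneg

variable [DecidableEq ι]

lemma trace_mul_self_eq_sum_eigenvalues_sq {A : Matrix ι ι 𝕜} (hA : A.IsHermitian) :
    (A * A).trace = ((∑ i, hA.eigenvalues i ^ 2 : ℝ) : 𝕜) := by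
  conv_lhs => rw [hA.spectral_theorem, ← map_mul, Unitary.conjStarAlgAut_apply,
    Matrix.trace_mul_cycle, Unitary.coe_star_mul_self, one_mul, Matrix.diagonal_mul_diagonal,
    Matrix.trace_diagonal]
  push_cast
  exact sum_congr rfl fun i _ => (sq _).symm

lemma posSemidef_algebraMap_sub_iff {A : Matrix ι ι 𝕜} (hA : A.IsHermitian) (c : ℝ) :
    (algebraMap ℝ (Matrix ι ι 𝕜) c - A).PosSemidef ↔ ∀ i, hA.eigenvalues i ≤ c := by
  open scoped MatrixOrder in
  rw [← Matrix.le_iff, le_algebraMap_iff_spectrum_le (ha := hA.isSelfAdjoint),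
    hA.spectrum_real_eq_range_eigenvalues, Set.forall_mem_range]

lemma exists_sq_lt_trace_mul_self_and_posSemidef_sub {A : Matrix ι ι 𝕜} (hA : A.IsHermitian)
    (hneg : ¬ A.PosSemidef) :
    ∃ c : ℝ, c ^ 2 < RCLike.re (A * A).trace ∧ (algebraMap ℝ (Matrix ι ι 𝕜) c - A).PosSemidef := by
  obtain ⟨i, hi⟩ : ∃ i, hA.eigenvalues i < 0 := by
    simpa [hA.posSemidef_iff_eigenvalues_nonneg, Pi.le_def] using hneg
  set s := ∑ j ∈ univ.erase i, hA.eigenvalues j ^ 2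
  have hs : 0 ≤ s := sum_nonneg fun _ _ => sq_nonneg _
  refine ⟨√s, ?_, (posSemidef_algebraMap_sub_iff hA _).2 fun j => ?_⟩
  · rw [Real.sq_sqrt hs, trace_mul_self_eq_sum_eigenvalues_sq hA, RCLike.ofReal_re,
      ← add_sum_erase univ _ (mem_univ i)]
    exact lt_add_of_pos_left _ (sq_pos_of_neg hi)
  · obtain rfl | hj := eq_or_ne j i
    · exact hi.le.trans (Real.sqrt_nonneg s)
    · exact Real.le_sqrt_of_sq_le <| single_le_sum (f := fun j => hA.eigenvalues j ^ 2)
        (fun _ _ => sq_nonneg _) (mem_erase.2 ⟨hj, mem_univ j⟩)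

end Matrix

section Tensor

variable {m : ℕ} {d e : Fin m → ℕ}

lemma tensorVec_update_smul (v : ∀ i, EuclideanSpace ℂ (Fin (d i))) (i : Fin m) (c : ℂ) :
    tensorVec (update v i (c • v i)) = c • tensorVec v := by
  ext x
  have h := ((MultilinearMap.mkPiAlgebra ℂ (Fin m) ℂ).compLinearMap fun j =>
    EuclideanSpace.projₗ (𝕜 := ℂ) (x j)).map_update_smul v i c (v i)
  rw [update_eq_self] at h
  exact h

lemma IsProduct.smul [NeZero m] {ψ : Space d} (hψ : IsProduct ψ) (c : ℂ) : IsProduct (c • ψ) := by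
  obtain ⟨v, rfl⟩ := hψ
  exact ⟨_, (tensorVec_update_smul v 0 c).symm⟩

lemma tensorOp_conjTranspose (A : ∀ i, Matrix (Fin (e i)) (Fin (d i)) ℂ) :
    (tensorOp A)ᴴ = tensorOp fun i => (A i)ᴴ := by
  ext x y
  simp [tensorOp, Matrix.conjTranspose_apply]

lemma tensorOp_mul {c : Fin m → ℕ} (A : ∀ i, Matrix (Fin (e i)) (Fin (d i)) ℂ)
    (B : ∀ i, Matrix (Fin (d i)) (Fin (c i)) ℂ) :
    tensorOp A * tensorOp B = tensorOp fun i => A i * B i := by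
  ext x y
  simp [tensorOp, Matrix.mul_apply, Fintype.prod_sum, prod_mul_distrib]

lemma tensorOp_one : tensorOp (fun i => (1 : Matrix (Fin (d i)) (Fin (d i)) ℂ)) = 1 := by
  ext x y
  simp [tensorOp, Matrix.one_apply, prod_ite_zero, funext_iff]

lemma tensorOp_update_sum {ι : Type*} (s : Finset ι)
    (A : ∀ i, Matrix (Fin (e i)) (Fin (d i)) ℂ) (i : Fin m)
    (B : ι → Matrix (Fin (e i)) (Fin (d i)) ℂ) :
    tensorOp (update A i (∑ o ∈ s, B o)) = ∑ o ∈ s, tensorOp (update A i (B o)) := by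
  ext x y
  rw [Matrix.sum_apply]
  exact ((MultilinearMap.mkPiAlgebra ℂ (Fin m) ℂ).compLinearMap fun j =>
    Matrix.entryLinearMap ℂ ℂ (x j) (y j)).map_update_sum s i B A

lemma sum_conjTranspose_tensorOp_mul_self {ι : Type*} [Fintype ι] {e : ι → Fin m → ℕ} {i : Fin m}
    {A : ∀ (o : ι) (j : Fin m), Matrix (Fin (e o j)) (Fin (d j)) ℂ}
    (measurement : ∑ o, (A o i)ᴴ * A o i = 1)
    (isometry : ∀ o, ∀ j, j ≠ i → (A o j)ᴴ * A o j = 1) :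
    ∑ o, (tensorOp (A o))ᴴ * tensorOp (A o) = 1 := by
  have update_one (o : ι) :
      (fun j => (A o j)ᴴ * A o j) = update (fun _ => 1) i ((A o i)ᴴ * A o i) :=
    eq_update_iff.2 ⟨rfl, isometry o⟩
  simp_rw [tensorOp_conjTranspose, tensorOp_mul, update_one]
  rw [← tensorOp_update_sum, measurement, update_eq_self_iff.2 rfl, tensorOp_one]

end Tensor

section Projector

variable {m : ℕ} {d : Fin m → ℕ}

lemma proj_posSemidef (ψ : Space d) : (proj ψ).PosSemidef :=
  Matrix.posSemidef_vecMulVec_self_star ψ.ofLp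

lemma trace_proj_mul (ψ : Space d) (A : Op d) :
    (proj ψ * A).trace = star ψ.ofLp ⬝ᵥ (A *ᵥ ψ.ofLp) := by
  change (Matrix.vecMulVec ψ.ofLp (star ψ.ofLp) * A).trace = _
  rw [Matrix.vecMulVec_mul, Matrix.trace_vecMulVec, dotProduct_comm, Matrix.dotProduct_mulVec]

lemma fidelity_eq_re_trace (φ : Space d) (σ : Op d) : fidelity φ σ = (proj φ * σ).trace.re := by
  simp only [trace_proj_mul, fidelity, dotProduct, Matrix.mulVec, mul_sum, mul_assoc,
    Pi.star_apply]

lemma trace_proj (ψ : Space d) : (proj ψ).trace = ((‖ψ‖ ^ 2 : ℝ) : ℂ) := by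
  rw [← mul_one (proj ψ), trace_proj_mul, Matrix.one_mulVec, dotProduct_comm,
    ← EuclideanSpace.inner_eq_star_dotProduct, inner_self_eq_norm_sq_to_K]
  norm_cast

lemma trace_proj_mul_proj (ψ φ : Space d) :
    (proj ψ * proj φ).trace = ((‖inner ℂ ψ φ‖ ^ 2 : ℝ) : ℂ) := by
  have mulVec_eq : proj φ *ᵥ ψ.ofLp = inner ℂ φ ψ • φ.ofLp := by
    change Matrix.vecMulVec φ.ofLp (star φ.ofLp) *ᵥ ψ.ofLp = _
    rw [Matrix.vecMulVec_mulVec, op_smul_eq_smul, dotProduct_comm,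
      ← EuclideanSpace.inner_eq_star_dotProduct]
  rw [trace_proj_mul, mulVec_eq, dotProduct_smul, dotProduct_comm,
    ← EuclideanSpace.inner_eq_star_dotProduct, smul_eq_mul, ← inner_conj_symm φ ψ,
    Complex.conj_mul']
  norm_cast

lemma trace_proj_mul_self {ψ : Space d} (hψ : ‖ψ‖ = 1) : (proj ψ * proj ψ).trace = 1 := by
  simp [trace_proj_mul_proj, hψ]

lemma trace_proj_mul_one_sub_sum_proj {ι : Type*} [Fintype ι] (φ : Space d) (ψ : ι → Space d) :
    (proj φ * (1 - ∑ j, proj (ψ j))).trace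
      = ((‖φ‖ ^ 2 - ∑ j, ‖inner ℂ (ψ j) φ‖ ^ 2 : ℝ) : ℂ) := by
  simp only [mul_sub, mul_one, mul_sum, Matrix.trace_sub, Matrix.trace_sum, trace_proj,
    trace_proj_mul_proj, norm_inner_symm φ, Complex.ofReal_sub, Complex.ofReal_sum]

lemma one_sub_sum_proj_posSemidef {ι : Type*} [Fintype ι] {ψ : ι → Space d}
    (hψ : Orthonormal ℂ ψ) : (1 - ∑ j, proj (ψ j)).PosSemidef := by
  refine .of_dotProduct_mulVec_nonneg (Matrix.isHermitian_one.sub ?_) fun v => ?_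
  · exact (Matrix.posSemidef_sum _ fun j _ => proj_posSemidef (ψ j)).isHermitian
  · rw [← WithLp.ofLp_toLp 2 v, ← trace_proj_mul, trace_proj_mul_one_sub_sum_proj]
    exact Complex.zero_le_real.2 (sub_nonneg.2 (hψ.sum_inner_products_le _))

lemma inner_eq_zero_of_trace_proj_mul_sum_eq_zero {ι : Type*} [Fintype ι] {p : ι → ℝ}
    (hp : ∀ a, 0 ≤ p a) {φ : ι → Space d} {χ : Space d}
    (h : (proj χ * ∑ a, (p a : ℂ) • proj (φ a)).trace = 0) {a : ι} (ha : p a ≠ 0) :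
    inner ℂ χ (φ a) = 0 := by
  have sum_eq_zero : ∑ a, p a * ‖inner ℂ χ (φ a)‖ ^ 2 = 0 := by
    simp only [mul_sum, mul_smul_comm, Matrix.trace_sum, Matrix.trace_smul, trace_proj_mul_proj,
      smul_eq_mul] at h
    exact_mod_cast h
  have := (sum_eq_zero_iff_of_nonneg fun a _ => mul_nonneg (hp a) (sq_nonneg _)).1 sum_eq_zero a
    (mem_univ a)
  simpa [ha] using this

end Projector

section PartialTranspose

variable {m : ℕ} {d e : Fin m → ℕ} (S : Finset (Fin m))

/-- The exchange of the labels of the parties in `S` between a row label and a column label: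
partial transposition permutes the entries of an operator along it. -/
def swapLabels (d : Fin m → ℕ) : Equiv.Perm (Idx d × Idx d) :=
  Involutive.toPerm (fun p => (S.piecewise p.2 p.1, S.piecewise p.1 p.2)) fun p => by
    simp [piecewise_same]

lemma swapLabels_apply (p : Idx d × Idx d) :
    swapLabels S d p = (S.piecewise p.2 p.1, S.piecewise p.1 p.2) := rfl

lemma partialTranspose_apply (ρ : Op d) (x y : Idx d) :
    partialTranspose S ρ x y = ρ (S.piecewise y x) (S.piecewise x y) := rfl

lemma partialTranspose_conjTranspose (ρ : Op d) :
    (partialTranspose S ρ)ᴴ = partialTranspose S ρᴴ := rfl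

lemma partialTranspose_sub (ρ σ : Op d) :
    partialTranspose S (ρ - σ) = partialTranspose S ρ - partialTranspose S σ := rfl

lemma partialTranspose_smul (c : ℂ) (ρ : Op d) :
    partialTranspose S (c • ρ) = c • partialTranspose S ρ := rfl

lemma partialTranspose_sum {ι : Type*} (s : Finset ι) (ρ : ι → Op d) :
    partialTranspose S (∑ o ∈ s, ρ o) = ∑ o ∈ s, partialTranspose S (ρ o) := by
  ext x y
  simp [partialTranspose_apply, Matrix.sum_apply]

lemma partialTranspose_one : partialTranspose S (1 : Op d) = 1 := by
  ext x y
  have h : S.piecewise y x = S.piecewise x y ↔ x = y := by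
    refine ⟨fun h => ?_, fun h => by rw [h]⟩
    have := (swapLabels S d).injective (a₁ := (x, y)) (a₂ := (y, x)) (Prod.ext h h.symm)
    exact congrArg Prod.fst this
  simp only [partialTranspose_apply, Matrix.one_apply, h]

lemma trace_partialTranspose (ρ : Op d) : (partialTranspose S ρ).trace = ρ.trace := by
  simp [Matrix.trace, partialTranspose_apply, piecewise_same]

lemma trace_partialTranspose_mul_partialTranspose (ρ σ : Op d) :
    (partialTranspose S ρ * partialTranspose S σ).trace = (ρ * σ).trace := by
  simp only [Matrix.trace, Matrix.diag, Matrix.mul_apply, ← Fintype.sum_prod_type']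
  exact Fintype.sum_equiv (swapLabels S d) _ _ fun _ => rfl

lemma partialTranspose_tensorOp_mul_mul (A : ∀ i, Matrix (Fin (e i)) (Fin (d i)) ℂ) (ρ : Op d)
    (B : ∀ i, Matrix (Fin (d i)) (Fin (e i)) ℂ) :
    partialTranspose S (tensorOp A * ρ * tensorOp B)
      = tensorOp (S.piecewise (fun i => (B i)ᵀ) A) * partialTranspose S ρ
        * tensorOp (S.piecewise (fun i => (A i)ᵀ) B) := by
  ext x y
  simp only [partialTranspose_apply, Matrix.mul_apply, sum_mul, ← Fintype.sum_prod_type']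
  refine Fintype.sum_equiv (swapLabels S d) _ _ fun ⟨u, w⟩ => ?_
  simp only [swapLabels_apply, piecewise_idem_left, piecewise_idem_right, piecewise_same,
    mul_right_comm _ (ρ _ _)]
  congr 1
  simp only [tensorOp, Matrix.of_apply, ← prod_mul_distrib]
  refine prod_congr rfl fun i _ => ?_
  by_cases hi : i ∈ S <;> simp [hi, mul_comm]

variable {S} in
lemma posSemidef_partialTranspose_tensorOp_mul_mul {ρ : Op d}
    (hρ : (partialTranspose S ρ).PosSemidef) (A : ∀ i, Matrix (Fin (e i)) (Fin (d i)) ℂ) :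
    (partialTranspose S (tensorOp A * ρ * (tensorOp A)ᴴ)).PosSemidef := by
  have conjTranspose_eq : tensorOp (S.piecewise (fun i => (A i)ᵀ) fun i => (A i)ᴴ)
      = (tensorOp (S.piecewise (fun i => (A i)ᴴᵀ) A))ᴴ := by
    rw [tensorOp_conjTranspose]
    congr 1
    funext i
    ext a b
    by_cases hi : i ∈ S <;> simp [hi]
  rw [tensorOp_conjTranspose, partialTranspose_tensorOp_mul_mul, conjTranspose_eq]
  exact hρ.mul_mul_conjTranspose_same _

/-- The local vectors `v i`, complex conjugated (in the computational basis) for the parties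
in `S`. -/
def conjOn (v : ∀ i, EuclideanSpace ℂ (Fin (d i))) : ∀ i, EuclideanSpace ℂ (Fin (d i)) :=
  S.piecewise (fun i => WithLp.toLp 2 (star (v i).ofLp)) v

lemma partialTranspose_proj_tensorVec (v : ∀ i, EuclideanSpace ℂ (Fin (d i))) :
    partialTranspose S (proj (tensorVec v)) = proj (tensorVec (conjOn S v)) := by
  ext x y
  simp only [partialTranspose_apply, proj, tensorVec, conjOn, Matrix.of_apply, star_prod,
    ← prod_mul_distrib]
  refine prod_congr rfl fun i _ => ?_
  by_cases hi : i ∈ S <;> simp [hi, mul_comm]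

lemma norm_inner_tensorVec_conjOn (v w : ∀ i, EuclideanSpace ℂ (Fin (d i))) :
    ‖inner ℂ (tensorVec (conjOn S v)) (tensorVec (conjOn S w))‖
      = ‖inner ℂ (tensorVec v) (tensorVec w)‖ := by
  have h := trace_partialTranspose_mul_partialTranspose S (proj (tensorVec v)) (proj (tensorVec w))
  rw [partialTranspose_proj_tensorVec, partialTranspose_proj_tensorVec, trace_proj_mul_proj,
    trace_proj_mul_proj, Complex.ofReal_inj] at h
  exact (sq_eq_sq₀ (norm_nonneg _) (norm_nonneg _)).1 h

lemma orthonormal_tensorVec_conjOn {ι : Type*} {v : ι → ∀ i, EuclideanSpace ℂ (Fin (d i))}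
    (hv : Orthonormal ℂ fun j => tensorVec (v j)) :
    Orthonormal ℂ fun j => tensorVec (conjOn S (v j)) := by
  refine ⟨fun j => ?_, fun j k hjk => ?_⟩
  · have h := norm_inner_tensorVec_conjOn S (v j) (v j)
    exact (pow_eq_one_iff_of_nonneg (norm_nonneg _) two_ne_zero).1 (by simpa [hv.1 j] using h)
  · have inner_eq_zero : inner ℂ (tensorVec (v j)) (tensorVec (v k)) = 0 := hv.2 hjk
    change inner ℂ _ _ = (0 : ℂ)
    rw [← norm_eq_zero, norm_inner_tensorVec_conjOn, inner_eq_zero, norm_zero]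

end PartialTranspose

section ComplementaryState

variable {m : ℕ} {d : Fin m → ℕ} {n : ℕ} {ψ : Fin n → Space d}

lemma IsPB.card_lt (h : IsPB ψ) : n < ∏ i, d i := by
  have := Submodule.finrank_lt h.incomplete
  rw [finrank_span_eq_card h.orthonormal.linearIndependent] at this
  simpa using this

lemma IsPB.coeff_pos (h : IsPB ψ) : 0 < 1 / (((∏ i, d i : ℕ) : ℂ) - (n : ℂ)) :=
  one_div_pos.2 (sub_pos.2 (by exact_mod_cast h.card_lt))

lemma trace_one_sub_sum_proj (h : ∀ j, ‖ψ j‖ = 1) :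
    (1 - ∑ j, proj (ψ j)).trace = ((∏ i, d i : ℕ) : ℂ) - (n : ℂ) := by
  simp [Matrix.trace_sub, Matrix.trace_sum, Matrix.trace_one, trace_proj, h]

lemma IsPB.isDensity_complementaryState (h : IsPB ψ) : IsDensity (complementaryState ψ) := by
  refine ⟨(one_sub_sum_proj_posSemidef h.orthonormal).smul h.coeff_pos.le, ?_⟩
  rw [complementaryState, Matrix.trace_smul, trace_one_sub_sum_proj h.orthonormal.1, smul_eq_mul]
  exact one_div_mul_cancel (one_div_pos.1 h.coeff_pos).ne'

lemma IsPB.posSemidef_partialTranspose_complementaryState (h : IsPB ψ) (S : Finset (Fin m)) :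
    (partialTranspose S (complementaryState ψ)).PosSemidef := by
  choose v hv using h.product
  obtain rfl : ψ = fun j => tensorVec (v j) := funext hv
  simp only [complementaryState, partialTranspose_smul, partialTranspose_sub,
    partialTranspose_one, partialTranspose_sum, partialTranspose_proj_tensorVec]
  exact (one_sub_sum_proj_posSemidef (orthonormal_tensorVec_conjOn S h.orthonormal)).smul
    h.coeff_pos.le

lemma trace_proj_mul_complementaryState (h : Orthonormal ℂ ψ) (j : Fin n) :
    (proj (ψ j) * complementaryState ψ).trace = 0 := by
  have : ∑ k, ‖inner ℂ (ψ k) (ψ j)‖ ^ 2 = 1 := by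
    rw [Fintype.sum_eq_single j fun k hk => by rw [h.2 hk]; simp]
    simp [h.1 j]
  simp only [complementaryState, mul_smul_comm, Matrix.trace_smul, trace_proj_mul_one_sub_sum_proj,
    this, h.1 j]
  simp

lemma IsUPB.not_isSeparable_complementaryState (h : IsUPB ψ) :
    ¬ IsSeparable (complementaryState ψ) := by
  rintro ⟨k, p, φ, hp, hsum, hφ, hρ⟩
  obtain ⟨a, -, ha⟩ := exists_ne_zero_of_sum_ne_zero (hsum.trans_ne one_ne_zero)
  have hinner (j : Fin n) : inner ℂ (ψ j) (φ a) = 0 :=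
    inner_eq_zero_of_trace_proj_mul_sum_eq_zero hp
      (hρ ▸ trace_proj_mul_complementaryState h.orthonormal j) ha
  have hmem : φ a ∈ (Submodule.span ℂ (Set.range ψ))ᗮ := by
    rw [← Submodule.span_singleton_le_iff_mem, ← Submodule.isOrtho_iff_le, Submodule.isOrtho_comm,
      Submodule.isOrtho_span]
    rintro _ ⟨j, rfl⟩ _ rfl
    exact hinner j
  exact one_ne_zero ((hφ a).1.symm.trans (by rw [h.unextendible _ hmem (hφ a).2, norm_zero]))

-- With no party the empty product `1` spans the space, and a product basis has to be empty.
lemma IsUPB.neZero_parties (h : IsUPB ψ) : NeZero m := by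
  refine ⟨fun hm => ?_⟩
  subst hm
  obtain rfl : n = 0 := by simpa using h.card_lt
  have h0 := h.unextendible (tensorVec fun i => i.elim0) (by simp) ⟨_, rfl⟩
  simpa [tensorVec] using congrArg (fun χ : Space d => χ fun i => i.elim0) h0

end ComplementaryState

section Copies

variable {m : ℕ} {d : Fin m → ℕ}

lemma partialTranspose_copies (S : Finset (Fin m)) (ρ : Op d) (N : ℕ) :
    partialTranspose S (copies ρ N) = copies (partialTranspose S ρ) N := by
  ext x y
  simp only [partialTranspose, copies, Matrix.of_apply]
  refine prod_congr rfl fun k _ => ?_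
  congr 1 <;> funext i <;> split_ifs <;> rfl

lemma copies_posSemidef {ρ : Op d} (hρ : ρ.PosSemidef) (N : ℕ) : (copies ρ N).PosSemidef :=
  posSemidef_prod_submatrix hρ
    (fun k (x : Idx fun i => d i ^ N) i => finFunctionFinEquiv.symm (x i) k) univ

lemma trace_copies (ρ : Op d) (N : ℕ) : (copies ρ N).trace = ρ.trace ^ N := by
  let E : Idx (fun i => d i ^ N) ≃ (Fin N → Idx d) :=
    (Equiv.piCongrRight fun _ => finFunctionFinEquiv.symm).trans (Equiv.piComm _)
  calc (copies ρ N).trace = ∑ f : Fin N → Idx d, ∏ k, ρ (f k) (f k) :=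
        Fintype.sum_equiv E _ _ fun _ => rfl
    _ = ∏ _k : Fin N, ρ.trace := (Fintype.prod_sum fun _ x => ρ x x).symm
    _ = ρ.trace ^ N := by simp

end Copies

namespace LOCC

variable {m : ℕ} {d τ : Fin m → ℕ}

lemma trace_apply (P : LOCC τ d) (ρ : Op d) : (P.apply ρ).trace = ρ.trace := by
  induction P with
  | done => rfl
  | round i r e A measurement isometry next ih =>
    calc (∑ o, (next o).apply (tensorOp (A o) * ρ * (tensorOp (A o))ᴴ)).trace
        = ∑ o, ((tensorOp (A o))ᴴ * tensorOp (A o) * ρ).trace := by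
          simp only [Matrix.trace_sum, ih]
          exact sum_congr rfl fun o _ => Matrix.trace_mul_cycle _ _ _
      _ = ρ.trace := by
          rw [← Matrix.trace_sum, ← sum_mul,
            sum_conjTranspose_tensorOp_mul_self measurement isometry, one_mul]

lemma posSemidef_partialTranspose_apply {S : Finset (Fin m)} (P : LOCC τ d) {ρ : Op d}
    (hρ : (partialTranspose S ρ).PosSemidef) : (partialTranspose S (P.apply ρ)).PosSemidef := by
  induction P with
  | done => exact hρ
  | round i r e A measurement isometry next ih =>
    rw [LOCC.apply, partialTranspose_sum]
    exact Matrix.posSemidef_sum _ fun o _ =>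
      ih o (posSemidef_partialTranspose_tensorOp_mul_mul hρ (A o))

end LOCC

section Fidelity

variable {m : ℕ} {τ : Fin m → ℕ}

lemma mul_eq_mul_piecewise_of_posSemidef_partialTranspose_proj {φ : Space τ} {S : Finset (Fin m)}
    (h : (partialTranspose S (proj φ)).PosSemidef) (x y : Idx τ) :
    φ x * φ y = φ (S.piecewise y x) * φ (S.piecewise x y) := by
  set u := S.piecewise y x with hu
  set w := S.piecewise x y with hw
  set δ := φ x * φ y - φ u * φ w with hδ
  -- If `C` is the coefficient matrix of `φ`, with rows indexed by the labels of the parties in `S`,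
  -- and `W = V Cᴴ`, then the quadratic form at `V` is `tr (W̄ W)`. This choice of `V` makes `W`
  -- antisymmetric with entries `±star δ`.
  let V : Fin 4 → ℂ := ![-star (φ w), -star (φ y), star (φ u), star (φ x)]
  have quadForm_eq : star V ⬝ᵥ
      ((partialTranspose S (proj φ)).submatrix ![x, u, y, w] ![x, u, y, w] *ᵥ V)
      = ((-2 * ‖δ‖ ^ 2 : ℝ) : ℂ) := by
    push_cast
    rw [← Complex.mul_conj', hδ]
    simp only [V, dotProduct, Matrix.mulVec, Fin.sum_univ_four, Matrix.submatrix_apply,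
      Pi.star_apply, partialTranspose_apply, proj, Matrix.of_apply, Matrix.cons_val, hu, hw,
      piecewise_idem_left, piecewise_idem_right, piecewise_same, star_neg, star_star,
      map_sub, map_mul, starRingEnd_apply]
    ring
  have nonneg := (h.submatrix ![x, u, y, w]).dotProduct_mulVec_nonneg V
  rw [quadForm_eq, Complex.zero_le_real] at nonneg
  have : ‖δ‖ = 0 := by nlinarith [sq_nonneg ‖δ‖]
  exact sub_eq_zero.1 (norm_eq_zero.1 this)

lemma eq_prod_div_mul_of_mul_eq_mul_update {φ : Space τ}
    (h : ∀ i x y, φ x * φ y = φ (update x i (y i)) * φ (update y i (x i)))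
    {z : Idx τ} (hz : φ z ≠ 0) (s : Finset (Fin m)) (x : Idx τ) :
    φ x = (∏ i ∈ s, φ (update z i (x i)) / φ z) * φ (s.piecewise z x) := by
  induction s using Finset.induction_on with
  | empty => simp
  | insert i s hi ih =>
    have exchange := h i (s.piecewise z x) z
    rw [piecewise_eq_of_notMem _ _ _ hi, ← piecewise_insert] at exchange
    rw [ih, prod_insert hi]
    field_simp
    linear_combination (∏ i ∈ s, φ (update z i (x i)) / φ z) * exchange

lemma isProduct_of_mul_eq_mul_update [NeZero m] {φ : Space τ}
    (h : ∀ i x y, φ x * φ y = φ (update x i (y i)) * φ (update y i (x i))) : IsProduct φ := by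
  by_cases h0 : ∃ z, φ z ≠ 0
  · obtain ⟨z, hz⟩ := h0
    let v : ∀ i, EuclideanSpace ℂ (Fin (τ i)) :=
      fun i => WithLp.toLp 2 fun k => φ (update z i k) / φ z
    have : φ = φ z • tensorVec v := by
      ext x
      rw [eq_prod_div_mul_of_mul_eq_mul_update h hz univ x, piecewise_univ, mul_comm]
      rfl
    exact this ▸ IsProduct.smul ⟨v, rfl⟩ _
  · have : φ = (0 : ℂ) • tensorVec 0 := by
      rw [zero_smul]
      exact PiLp.ext (by simpa using h0)
    exact this ▸ IsProduct.smul ⟨0, rfl⟩ _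

lemma exists_not_posSemidef_partialTranspose_proj [NeZero m] {φ : Space τ} (hφ : ¬ IsProduct φ) :
    ∃ i, ¬ (partialTranspose {i} (proj φ)).PosSemidef := by
  by_contra! h
  refine hφ (isProduct_of_mul_eq_mul_update fun i x y => ?_)
  simpa only [piecewise_singleton] using
    mul_eq_mul_piecewise_of_posSemidef_partialTranspose_proj (h i) x y

lemma exists_fidelity_le {φ : Space τ} (hφ : ‖φ‖ = 1) {S : Finset (Fin m)}
    (hS : ¬ (partialTranspose S (proj φ)).PosSemidef) :
    ∃ c < (1 : ℝ), ∀ σ : Op τ, σ.trace = 1 → (partialTranspose S σ).PosSemidef →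
      fidelity φ σ ≤ c := by
  have hherm : (partialTranspose S (proj φ)).IsHermitian := by
    rw [Matrix.IsHermitian, partialTranspose_conjTranspose, (proj_posSemidef φ).isHermitian]
  obtain ⟨c, hc, hpos⟩ := exists_sq_lt_trace_mul_self_and_posSemidef_sub hherm hS
  rw [trace_partialTranspose_mul_partialTranspose, trace_proj_mul_self hφ, RCLike.one_re,
    sq_lt_one_iff_abs_lt_one] at hc
  refine ⟨c, (abs_lt.1 hc).2, fun σ htr hσ => ?_⟩
  have trace_nonneg := trace_mul_nonneg hpos hσ
  rw [sub_mul, Matrix.trace_sub, trace_partialTranspose_mul_partialTranspose,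
    ← Algebra.smul_def, Matrix.trace_smul, trace_partialTranspose, htr] at trace_nonneg
  rw [fidelity_eq_re_trace]
  simpa using (Complex.le_def.1 trace_nonneg).1

lemma not_isDistillable [NeZero m] {d : Fin m → ℕ} {ρ : Op d} (htr : ρ.trace = 1)
    (hρ : ∀ i, (partialTranspose {i} ρ).PosSemidef) : ¬ IsDistillable ρ := by
  rintro ⟨τ, φ, hφ, hprod, hdist⟩
  obtain ⟨i, hi⟩ := exists_not_posSemidef_partialTranspose_proj hprod
  obtain ⟨c, hc, hbound⟩ := exists_fidelity_le hφ hi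
  obtain ⟨N, P, hP⟩ := hdist (1 - c) (sub_pos.2 hc)
  have htrace : (P.apply (copies ρ N)).trace = 1 := by
    rw [P.trace_apply, trace_copies, htr, one_pow]
  have hpos : (partialTranspose {i} (P.apply (copies ρ N))).PosSemidef :=
    P.posSemidef_partialTranspose_apply
      (partialTranspose_copies {i} ρ N ▸ copies_posSemidef (hρ i) N)
  exact (hbound _ htrace hpos).not_gt (by simpa using hP)

end Fidelity

end UPB

theorem theorem1 {m : ℕ} (d : Fin m → ℕ) {n : ℕ} (ψ : Fin n → UPB.Space d)
    (hψ : UPB.IsUPB ψ) :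
    UPB.IsBoundEntangled (UPB.complementaryState ψ) ∧
      ∀ S : Finset (Fin m),
        (UPB.partialTranspose S (UPB.complementaryState ψ)).PosSemidef := by
  have hdensity := hψ.isDensity_complementaryState
  have hppt := hψ.posSemidef_partialTranspose_complementaryState
  have := hψ.neZero_parties
  exact ⟨⟨hdensity, hψ.not_isSeparable_complementaryState,
    UPB.not_isDistillable hdensity.2 fun i => hppt {i}⟩, hppt⟩
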